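/- Let $*$ be a continuous t-norm on $[0,1]$, i.e. $([0,1],*,1)$ is a commutative monoid, $*$ is monotone in both variables, and $*\colon[0,1]^2\to[0,1]$ is continuous; let $p\to r=\max\{q\mid p*q\le r\}$. A $[0,1]_*$-set is a set $X$ with a map $\alpha\colon X\times X\to[0,1]$ such that, for all $x,y,z\in X$, $\alpha(x,y)\le\alpha(x,x)\wedge\alpha(y,y)$, $\alpha(x,y)=\alpha(y,x)$ and $\alpha(y,z)*(\alpha(y,y)\to\alpha(x,y))\le\alpha(x,z)$. A morphism $(X,\alpha)\to(Y,\beta)$ is a map $\phi\colon X\times Y\to[0,1]$ such that, for all $x,x'\in X$ and $y,y'\in Y$, $$\phi(x,y)\le\alpha(x,x)\wedge\beta(y,y),\qquad (\beta(y,y)\to\beta(y,y'))*\phi(x,y)*(\alpha(x,x)\to\alpha(x',x))\le\phi(x',y'),$$ $$\phi(x,y')*(\alpha(x,x)\to\phi(x,y))\le\beta(y,y'),\qquad \alpha(x,x')\le\bigvee_{y\in Y}\phi(x',y)*(\beta(y,y)\to\phi(x,y)).$$ The composite of $\phi\colon(X,\alpha)\to(Y,\beta)$ and $\psi\colon(Y,\beta)\to(Z,\gamma)$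 is $(\psi\circ\phi)(x,z)=\bigvee_{y\in Y}\psi(y,z)*(\beta(y,y)\to\phi(x,y))$, and the identity on $(X,\alpha)$ is $\alpha$. Let $[0,1]_*\text{-}\mathbf{Set}$ be the resulting category. Then $[0,1]_*\text{-}\mathbf{Set}$ is an (elementary) topos, that is, it has finite limits, is cartesian closed and has a subobject classifier, if and only if $*$ is the minimum t-norm, i.e. $p*q=\min\{p,q\}$ for all $p,q\in[0,1]$. -/

import Mathlib

open CategoryTheory CategoryTheory.Limits

universe v u

/-- A continuous t-norm on the unit interval: a commutative monoid structure on `[0,1]` with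
unit `1` that is monotone in both variables and jointly continuous. -/
structure ContinuousTNorm where
  op : unitInterval → unitInterval → unitInterval
  op_assoc : ∀ p q r, op (op p q) r = op p (op q r)
  op_comm : ∀ p q, op p q = op q p
  one_op : ∀ p, op 1 p = p
  op_mono : ∀ {p p' q q'}, p ≤ p' → q ≤ q' → op p q ≤ op p' q'
  continuous_op : Continuous fun x : unitInterval × unitInterval => op x.1 x.2

namespace ContinuousTNorm

variable (T : ContinuousTNorm)

/-- The residuum `p → r`, the largest `q` with `p * q ≤ r`. -/
noncomputable def imp (p r : unitInterval) : unitInterval :=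
  sSup {q | T.op p q ≤ r}

/-- The t-norm is the minimum t-norm on `[0,1]`. -/
def IsMinimum : Prop := ∀ p q : unitInterval, T.op p q = min p q

instance : Std.Associative T.op := ⟨T.op_assoc⟩

instance : Std.Commutative T.op := ⟨T.op_comm⟩

theorem op_one (p : unitInterval) : T.op p 1 = p := by rw [T.op_comm, T.one_op]

theorem op_le_left (p q : unitInterval) : T.op p q ≤ p := by
  simpa only [T.op_one] using T.op_mono (le_refl p) (unitInterval.le_one' : q ≤ 1)

theorem op_le_right (p q : unitInterval) : T.op p q ≤ q := by
  rw [T.op_comm]; exact T.op_le_left q p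

theorem op_zero (p : unitInterval) : T.op p 0 = 0 :=
  le_antisymm (T.op_le_right p 0) unitInterval.nonneg'

theorem continuous_op_right (p : unitInterval) : Continuous (T.op p) :=
  T.continuous_op.comp (continuous_const.prodMk continuous_id)

theorem op_imp_le (p r : unitInterval) : T.op p (T.imp p r) ≤ r := by
  have hc : IsClosed {q | T.op p q ≤ r} :=
    isClosed_le (T.continuous_op_right p) continuous_const
  have hn : {q | T.op p q ≤ r}.Nonempty :=
    ⟨0, (T.op_zero p).le.trans unitInterval.nonneg'⟩
  exact hc.isCompact.sSup_mem hn

theorem le_imp_iff {p q r : unitInterval} : q ≤ T.imp p r ↔ T.op p q ≤ r :=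
  ⟨fun h => (T.op_mono le_rfl h).trans (T.op_imp_le p r), fun h => le_sSup h⟩

theorem gc (p : unitInterval) : GaloisConnection (T.op p) (T.imp p) :=
  fun _ _ => T.le_imp_iff.symm

theorem op_iSup {ι : Sort*} (p : unitInterval) (f : ι → unitInterval) :
    T.op p (⨆ i, f i) = ⨆ i, T.op p (f i) := (T.gc p).l_iSup

theorem iSup_op {ι : Sort*} (p : unitInterval) (f : ι → unitInterval) :
    T.op (⨆ i, f i) p = ⨆ i, T.op (f i) p := by
  rw [T.op_comm, T.op_iSup]; simp only [T.op_comm p]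

theorem imp_self (p : unitInterval) : T.imp p p = 1 :=
  le_antisymm unitInterval.le_one' (T.le_imp_iff.2 (T.op_le_left p 1))

theorem op_imp_of_le {q w : unitInterval} (h : w ≤ q) : T.op q (T.imp q w) = w := by
  have hw : w ∈ Set.Icc (T.op q 0) (T.op q 1) :=
    ⟨(T.op_zero q).le.trans unitInterval.nonneg', h.trans (T.op_one q).ge⟩
  obtain ⟨s, hs⟩ := intermediate_value_univ (0 : unitInterval) 1 (T.continuous_op_right q) hw
  refine le_antisymm (T.op_imp_le q w) ?_
  calc w = T.op q s := hs.symm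
    _ ≤ _ := T.op_mono le_rfl (T.le_imp_iff.2 hs.le)

theorem op_imp_swap {a b q : unitInterval} (ha : a ≤ q) (hb : b ≤ q) :
    T.op a (T.imp q b) = T.op (T.imp q a) b := by
  conv_lhs => rw [← T.op_imp_of_le ha]
  conv_rhs => rw [← T.op_imp_of_le hb]
  ac_rfl

theorem op_imp_le_right {a b q : unitInterval} (ha : a ≤ q) (hb : b ≤ q) :
    T.op a (T.imp q b) ≤ b := by
  rw [T.op_imp_swap ha hb]; exact T.op_le_right _ _

theorem op_imp_iSup {ι : Sort*} {a q : unitInterval} {f : ι → unitInterval} (ha : a ≤ q)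
    (hf : ∀ i, f i ≤ q) : T.op a (T.imp q (⨆ i, f i)) = ⨆ i, T.op a (T.imp q (f i)) := by
  rw [T.op_imp_swap ha (iSup_le hf), T.op_iSup]
  exact iSup_congr fun i => (T.op_imp_swap ha (hf i)).symm

theorem imp_mono_right (q : unitInterval) {a b : unitInterval} (h : a ≤ b) :
    T.imp q a ≤ T.imp q b := T.le_imp_iff.2 ((T.op_imp_le q a).trans h)

/-- Adding a scalar inside a residuum. -/
theorem op_imp_le_imp_op (a q b : unitInterval) : T.op a (T.imp q b) ≤ T.imp q (T.op a b) := by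
  rw [T.le_imp_iff]
  calc T.op q (T.op a (T.imp q b)) = T.op a (T.op q (T.imp q b)) := by ac_rfl
    _ ≤ _ := T.op_mono le_rfl (T.op_imp_le q b)

end ContinuousTNorm

/-- A `[0,1]_*`-set: a set with a `[0,1]_*`-valued equality `α`. -/
structure TNormSet (T : ContinuousTNorm) : Type (u + 1) where
  carrier : Type u
  α : carrier → carrier → unitInterval
  le_min : ∀ x y, α x y ≤ min (α x x) (α y y)
  symm : ∀ x y, α x y = α y x
  trans : ∀ x y z, T.op (α y z) (T.imp (α y y) (α x y)) ≤ α x z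

namespace TNormSet

variable {T : ContinuousTNorm}

theorem le_left (X : TNormSet.{u} T) (x y : X.carrier) : X.α x y ≤ X.α x x :=
  (X.le_min x y).trans (min_le_left _ _)

theorem le_right (X : TNormSet.{u} T) (x y : X.carrier) : X.α x y ≤ X.α y y :=
  (X.le_min x y).trans (min_le_right _ _)

/-- A morphism of `[0,1]_*`-sets. -/
@[ext]
structure Hom (X Y : TNormSet.{u} T) : Type u where
  rel : X.carrier → Y.carrier → unitInterval
  rel_le_min : ∀ x y, rel x y ≤ min (X.α x x) (Y.α y y)
  rel_compat : ∀ x x' y y',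
    T.op (T.op (T.imp (Y.α y y) (Y.α y y')) (rel x y)) (T.imp (X.α x x) (X.α x' x)) ≤ rel x' y'
  rel_single : ∀ x y y', T.op (rel x y') (T.imp (X.α x x) (rel x y)) ≤ Y.α y y'
  rel_total : ∀ x x', X.α x x' ≤ ⨆ y, T.op (rel x' y) (T.imp (Y.α y y) (rel x y))

namespace Hom

variable {X Y Z W : TNormSet.{u} T}

theorem rel_le_left (f : Hom X Y) (x : X.carrier) (y : Y.carrier) : f.rel x y ≤ X.α x x :=
  (f.rel_le_min x y).trans (min_le_left _ _)

theorem rel_le_right (f : Hom X Y) (x : X.carrier) (y : Y.carrier) : f.rel x y ≤ Y.α y y :=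
  (f.rel_le_min x y).trans (min_le_right _ _)

theorem rel_compat_left (f : Hom X Y) (x x' : X.carrier) (y : Y.carrier) :
    T.op (f.rel x y) (T.imp (X.α x x) (X.α x' x)) ≤ f.rel x' y := by
  simpa only [T.imp_self, T.one_op] using f.rel_compat x x' y y

theorem rel_compat_right (f : Hom X Y) (x : X.carrier) (y y' : Y.carrier) :
    T.op (T.imp (Y.α y y) (Y.α y y')) (f.rel x y) ≤ f.rel x y' := by
  simpa only [T.imp_self, T.op_one] using f.rel_compat x x y y'

/-- The identity morphism of `(X, α)` is `α` itself. -/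
def id (X : TNormSet.{u} T) : Hom X X where
  rel := X.α
  rel_le_min := X.le_min
  rel_compat x x' y y' := by
    have h1 : T.op (T.imp (X.α y y) (X.α y y')) (X.α x y) ≤ X.α x y' := by
      rw [← T.op_imp_swap (X.le_left y y') (X.le_right x y)]
      exact X.trans x y y'
    exact (T.op_mono h1 le_rfl).trans (X.trans x' x y')
  rel_single x y y' := by
    rw [X.symm x y]
    exact X.trans y x y'
  rel_total x x' := by
    refine le_trans ?_ (le_iSup _ x')
    rw [T.op_imp_of_le (X.le_right x x')]

/-- Composition of morphisms of `[0,1]_*`-sets (in diagrammatic order). -/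
noncomputable def comp (f : Hom X Y) (g : Hom Y Z) : Hom X Z where
  rel x z := ⨆ y, T.op (g.rel y z) (T.imp (Y.α y y) (f.rel x y))
  rel_le_min x z := iSup_le fun y => _root_.le_min
    ((T.op_imp_le_right (g.rel_le_left y z) (f.rel_le_right x y)).trans (f.rel_le_left x y))
    ((T.op_le_left _ _).trans (g.rel_le_right y z))
  rel_compat x x' z z' := by
    rw [T.op_iSup, T.iSup_op]
    refine iSup_mono fun y => ?_
    calc
      T.op (T.op (T.imp (Z.α z z) (Z.α z z')) (T.op (g.rel y z) (T.imp (Y.α y y) (f.rel x y))))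
          (T.imp (X.α x x) (X.α x' x))
        = T.op (T.op (T.imp (Z.α z z) (Z.α z z')) (g.rel y z))
          (T.op (T.imp (X.α x x) (X.α x' x)) (T.imp (Y.α y y) (f.rel x y))) := by ac_rfl
      _ ≤ T.op (g.rel y z') (T.imp (Y.α y y) (f.rel x' y)) := by
        refine T.op_mono (g.rel_compat_right y z z') ((T.op_imp_le_imp_op _ _ _).trans ?_)
        refine T.imp_mono_right _ ?_
        rw [T.op_comm]
        exact f.rel_compat_left x x' y
  rel_single x z z' := by
    have hle : ∀ y z, T.op (g.rel y z) (T.imp (Y.α y y) (f.rel x y)) ≤ f.rel x y := fun y z =>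
      T.op_imp_le_right (g.rel_le_left y z) (f.rel_le_right x y)
    rw [T.iSup_op]
    refine iSup_le fun y' => ?_
    rw [T.op_imp_iSup ((hle y' z').trans (f.rel_le_left x y'))
      fun y => (hle y z).trans (f.rel_le_left x y)]
    refine iSup_le fun y => ?_
    have e1 := T.op_imp_swap (g.rel_le_left y' z') (f.rel_le_right x y')
    have e2 := T.op_imp_swap (g.rel_le_left y z) (f.rel_le_right x y)
    have e3 := T.op_imp_swap (f.rel_le_left x y') ((hle y z).trans (f.rel_le_left x y))
    have e4 := T.op_imp_swap (f.rel_le_left x y') (f.rel_le_left x y)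
    have e5 := T.op_imp_swap (g.rel_le_left y' z') (Y.le_right y y')
    calc
      T.op (T.op (g.rel y' z') (T.imp (Y.α y' y') (f.rel x y')))
          (T.imp (X.α x x) (T.op (g.rel y z) (T.imp (Y.α y y) (f.rel x y))))
        = T.op (T.imp (Y.α y' y') (g.rel y' z')) (T.op (f.rel x y')
          (T.imp (X.α x x) (T.op (g.rel y z) (T.imp (Y.α y y) (f.rel x y))))) := by
          rw [e1]; ac_rfl
      _ = T.op (T.imp (Y.α y' y') (g.rel y' z')) (T.op (T.imp (Y.α y y) (g.rel y z))
          (T.op (f.rel x y') (T.imp (X.α x x) (f.rel x y)))) := by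
          rw [e3, e2, e4]; ac_rfl
      _ ≤ T.op (T.imp (Y.α y' y') (g.rel y' z')) (T.op (T.imp (Y.α y y) (g.rel y z))
          (Y.α y y')) := T.op_mono le_rfl (T.op_mono le_rfl (f.rel_single x y y'))
      _ = T.op (T.op (T.imp (Y.α y' y') (g.rel y' z')) (Y.α y y'))
          (T.imp (Y.α y y) (g.rel y z)) := by ac_rfl
      _ ≤ T.op (g.rel y z') (T.imp (Y.α y y) (g.rel y z)) := by
          rw [← e5]; exact T.op_mono (g.rel_compat_left y' y z') le_rfl
      _ ≤ Z.α z z' := g.rel_single y z z'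
  rel_total x x' := by
    refine (f.rel_total x x').trans (iSup_le fun y => ?_)
    have e : T.op (f.rel x' y) (T.imp (Y.α y y) (f.rel x y)) =
        T.op (Y.α y y) (T.op (T.imp (Y.α y y) (f.rel x' y)) (T.imp (Y.α y y) (f.rel x y))) := by
      conv_lhs => rw [← T.op_imp_of_le (f.rel_le_right x' y)]
      ac_rfl
    rw [e]
    refine (T.op_mono (g.rel_total y y) le_rfl).trans ?_
    rw [T.iSup_op]
    refine iSup_mono fun z => ?_
    calc
      T.op (T.op (g.rel y z) (T.imp (Z.α z z) (g.rel y z)))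
          (T.op (T.imp (Y.α y y) (f.rel x' y)) (T.imp (Y.α y y) (f.rel x y)))
        = T.op (T.op (g.rel y z) (T.imp (Y.α y y) (f.rel x' y)))
          (T.op (T.imp (Y.α y y) (f.rel x y)) (T.imp (Z.α z z) (g.rel y z))) := by ac_rfl
      _ ≤ _ := by
        refine T.op_mono (le_iSup (fun y => T.op (g.rel y z) (T.imp (Y.α y y) (f.rel x' y))) y)
          ((T.op_imp_le_imp_op _ _ _).trans (T.imp_mono_right _ ?_))
        rw [T.op_comm]
        exact le_iSup (fun y => T.op (g.rel y z) (T.imp (Y.α y y) (f.rel x y))) y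

theorem id_comp (f : Hom X Y) : comp (id X) f = f := by
  ext1; funext x y
  refine le_antisymm (iSup_le fun x' => f.rel_compat_left x' x y) ?_
  refine le_trans ?_ (le_iSup (fun x' => T.op (f.rel x' y) (T.imp (X.α x' x') (X.α x x'))) x)
  rw [T.imp_self, T.op_one]

theorem comp_id (f : Hom X Y) : comp f (id Y) = f := by
  ext1; funext x y
  refine le_antisymm (iSup_le fun y' => ?_) ?_
  · exact (T.op_imp_swap (Y.le_left y' y) (f.rel_le_right x y')).le.trans
      (f.rel_compat_right x y' y)
  · refine le_trans ?_ (le_iSup (fun y' => T.op (Y.α y' y) (T.imp (Y.α y' y') (f.rel x y'))) y)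
    rw [T.op_imp_of_le (f.rel_le_right x y)]

theorem assoc (f : Hom X Y) (g : Hom Y Z) (h : Hom Z W) :
    comp (comp f g) h = comp f (comp g h) := by
  ext1; funext x w
  have hle : ∀ y z, T.op (g.rel y z) (T.imp (Y.α y y) (f.rel x y)) ≤ Z.α z z := fun y z =>
    (T.op_le_left _ _).trans (g.rel_le_right y z)
  have hL : (comp (comp f g) h).rel x w = ⨆ z, ⨆ y,
      T.op (h.rel z w) (T.imp (Z.α z z) (T.op (g.rel y z) (T.imp (Y.α y y) (f.rel x y)))) :=
    iSup_congr fun z => T.op_imp_iSup (h.rel_le_left z w) fun y => hle y z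
  have hR : (comp f (comp g h)).rel x w = ⨆ y, ⨆ z,
      T.op (T.op (h.rel z w) (T.imp (Z.α z z) (g.rel y z))) (T.imp (Y.α y y) (f.rel x y)) :=
    iSup_congr fun y => T.iSup_op _ _
  rw [hL, hR, iSup_comm]
  refine iSup_congr fun y => iSup_congr fun z => ?_
  rw [T.op_imp_swap (h.rel_le_left z w) (hle y z),
    T.op_imp_swap (h.rel_le_left z w) (g.rel_le_right y z)]
  ac_rfl

end Hom

/-- The category `[0,1]_*-Set`. -/
noncomputable instance : Category.{u} (TNormSet.{u} T) where
  Hom := Hom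
  id := Hom.id
  comp := Hom.comp
  id_comp := Hom.id_comp
  comp_id := Hom.comp_id
  assoc := Hom.assoc

end TNormSet

/-- An (elementary) topos: a category with finite limits which is cartesian closed (every
functor `- ⨯ Y` has a right adjoint) and has a subobject classifier. -/
structure IsTopos (C : Type u) [Category.{v} C] : Prop where
  hasFiniteLimits : HasFiniteLimits C
  exponentiable : ∀ Y : C, (prod.functor.flip.obj Y).IsLeftAdjoint
  hasSubobjectClassifier : HasSubobjectClassifier C

/-!
Every topos is balanced, and a balanced `[0,1]_*-Set` forces every `p` to be idempotent. Indeed,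
let `e` be the greatest idempotent below `p`, and suppose that `e < p`. For `e ≤ r < p` consider
two elements of extent `p` that are equal to the degree `r`. An element of this set of extent
`c < p` forces `c` to be idempotent, hence `c ≤ e ≤ r`, and then it cannot distinguish the two
elements. So raising `r` within `[e, p)` yields a morphism that is mono and epi but not invertible.

Conversely, for the minimum t-norm `p * (q → r) = p ⊓ r` whenever `p, r ≤ q`, so that all
conditions can be read level by level: for each `r`, the relation `r < α x y` is a partial
equivalence relation, a morphism is at each level a functional relation, and composition is
relational composition. Finite limits, exponentials and the subobject classifier are then built as
for sets with partial equivalence relations.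
-/

open scoped symmDiff

namespace ContinuousTNorm

variable {T : ContinuousTNorm} {p s c : unitInterval}

theorem isMinimum_of_forall_idempotent (h : ∀ p, T.op p p = p) : T.IsMinimum := fun p q =>
  le_antisymm (le_min (T.op_le_left p q) (T.op_le_right p q)) <|
    calc min p q = T.op (min p q) (min p q) := (h _).symm
      _ ≤ T.op p q := T.op_mono (min_le_left _ _) (min_le_right _ _)

theorem exists_greatest_idempotent_le (p : unitInterval) :
    ∃ e, IsGreatest {c | c ≤ p ∧ T.op c c = c} e := by
  have hclosed : IsClosed {c | c ≤ p ∧ T.op c c = c} :=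
    isClosed_Iic.inter
      (isClosed_eq (T.continuous_op.comp (continuous_id.prodMk continuous_id)) continuous_id)
  exact hclosed.isCompact.exists_isGreatest ⟨0, unitInterval.nonneg', T.op_zero 0⟩

theorem op_eq_left_of_le_idempotent (hs : T.op s s = s) (h : p ≤ s) : T.op p s = p := by
  rw [← T.op_imp_of_le h, T.op_comm s, T.op_assoc, hs]

theorem exists_idempotent_op_eq_left (h : T.op c s = c) :
    ∃ e ≤ s, T.op e e = e ∧ T.op c e = c := by
  have hclosed : IsClosed {x | T.op c x = c} :=
    isClosed_eq (T.continuous_op_right c) continuous_const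
  obtain ⟨e, he, hleast⟩ := hclosed.isCompact.exists_isLeast ⟨s, h⟩
  have hee : T.op c (T.op e e) = c := by rw [← T.op_assoc, he, he]
  exact ⟨e, hleast h, le_antisymm (T.op_le_left e e) (hleast hee), he⟩

theorem eq_or_idempotent_of_op_imp_eq_left (hc : c ≤ p) (h : T.op c (T.imp p c) = c) :
    c = p ∨ T.op c c = c := by
  obtain ⟨e, hes, hee, hce⟩ := exists_idempotent_op_eq_left h
  have hpe : T.op p e ≤ c := T.le_imp_iff.1 hes
  rcases le_total p e with hle | hle
  · rw [op_eq_left_of_le_idempotent hee hle] at hpe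
    exact Or.inl (hc.antisymm hpe)
  · have hec : e ≤ c := hee.ge.trans ((T.op_mono hle le_rfl).trans hpe)
    obtain rfl : c = e := (hce.ge.trans (T.op_le_right c e)).antisymm hec
    exact Or.inr hee

theorem op_imp_eq_inf_of_op_imp_eq_left {a b q : unitInterval} (ha : a ≤ q) (hb : b ≤ q)
    (h : T.op a (T.imp q a) = a) : T.op a (T.imp q b) = a ⊓ b := by
  refine le_antisymm (le_inf (T.op_le_left _ _) (T.op_imp_le_right ha hb)) ?_
  calc a ⊓ b = T.op (T.imp a (a ⊓ b)) (T.op a (T.imp q a)) := by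
        rw [h, T.op_comm, T.op_imp_of_le inf_le_left]
    _ = T.op a (T.op (T.imp a (a ⊓ b)) (T.imp q a)) := by ac_rfl
    _ ≤ T.op a (T.imp q b) := T.op_mono le_rfl <| (T.op_imp_le_imp_op _ _ _).trans <|
        T.imp_mono_right _ <| by
          rw [T.op_comm, T.op_imp_of_le inf_le_left]; exact inf_le_right

end ContinuousTNorm

namespace TNormSet

variable {T : ContinuousTNorm} {X Y Z : TNormSet.{u} T}

theorem op_imp_α_le (X : TNormSet.{u} T) (x y z : X.carrier) :
    T.op (T.imp (X.α y y) (X.α y z)) (X.α x y) ≤ X.α x z := by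
  rw [← T.op_imp_swap (X.le_left y z) (X.le_right x y)]
  exact X.trans x y z

namespace Hom

theorem ext_rel {f g : X ⟶ Y} (h : ∀ x, f.rel x = g.rel x) : f = g :=
  Hom.ext (funext h)

theorem comp_rel (f : X ⟶ Y) (g : Y ⟶ Z) (x : X.carrier) (z : Z.carrier) :
    (f ≫ g).rel x z = ⨆ y, T.op (g.rel y z) (T.imp (Y.α y y) (f.rel x y)) := rfl

theorem comp_rel_of_rel_eq_α {f : X ⟶ Y} {x : X.carrier} {y : Y.carrier} (h : f.rel x = Y.α y)
    (g : Y ⟶ Z) : (f ≫ g).rel x = g.rel y := by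
  conv_rhs => rw [← Category.id_comp g]
  funext z
  rw [comp_rel, comp_rel, h]
  rfl

section graph

variable {e : X.carrier → Y.carrier}

theorem op_imp_α_map_eq_inf (he : ∀ x x', X.α x x' ≤ Y.α (e x) (e x'))
    (hext : ∀ x, T.op (X.α x x) (T.imp (Y.α (e x) (e x)) (X.α x x)) = X.α x x)
    (x : X.carrier) (y : Y.carrier) :
    T.op (X.α x x) (T.imp (Y.α (e x) (e x)) (Y.α (e x) y)) = X.α x x ⊓ Y.α (e x) y :=
  ContinuousTNorm.op_imp_eq_inf_of_op_imp_eq_left (he x x) (Y.le_left _ _) (hext x)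

theorem inf_α_map_compat_left (he : ∀ x x', X.α x x' ≤ Y.α (e x) (e x'))
    (hext : ∀ x, T.op (X.α x x) (T.imp (Y.α (e x) (e x)) (X.α x x)) = X.α x x)
    (x x' : X.carrier) (y : Y.carrier) :
    T.op (X.α x x ⊓ Y.α (e x) y) (T.imp (X.α x x) (X.α x' x)) ≤ X.α x' x' ⊓ Y.α (e x') y := by
  refine le_inf ?_ ?_
  · refine (T.op_mono inf_le_left le_rfl).trans ?_
    rw [T.op_imp_of_le (X.le_right x' x)]
    exact X.le_left x' x
  · calc T.op (X.α x x ⊓ Y.α (e x) y) (T.imp (X.α x x) (X.α x' x))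
        = T.op (T.imp (Y.α (e x) (e x)) (Y.α (e x) y))
            (T.op (X.α x x) (T.imp (X.α x x) (X.α x' x))) := by
          rw [← op_imp_α_map_eq_inf he hext]; ac_rfl
      _ ≤ T.op (T.imp (Y.α (e x) (e x)) (Y.α (e x) y)) (Y.α (e x') (e x)) :=
          T.op_mono le_rfl ((T.op_imp_le _ _).trans (he x' x))
      _ ≤ Y.α (e x') y := Y.op_imp_α_le _ _ _

/-- The graph of a map `e` between the underlying sets which does not decrease degrees of
equality. The condition `hext` says that the extent of `x` is obtained by cutting down that of
`e x`; it holds if `e` preserves extents, and always for the minimum t-norm. -/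
noncomputable def graph (e : X.carrier → Y.carrier)
    (he : ∀ x x', X.α x x' ≤ Y.α (e x) (e x'))
    (hext : ∀ x, T.op (X.α x x) (T.imp (Y.α (e x) (e x)) (X.α x x)) = X.α x x) : X ⟶ Y :=
  { rel := fun x y => X.α x x ⊓ Y.α (e x) y
    rel_le_min := fun x y => inf_le_inf le_rfl (Y.le_right _ _)
    rel_compat := fun x x' y y' => by
      rw [T.op_assoc]
      refine (T.op_mono le_rfl (inf_α_map_compat_left he hext x x' y)).trans (le_inf ?_ ?_)
      · exact (T.op_le_right _ _).trans inf_le_left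
      · exact (T.op_mono le_rfl inf_le_right).trans (Y.op_imp_α_le _ _ _)
    rel_single := fun x y y' =>
      calc T.op (X.α x x ⊓ Y.α (e x) y') (T.imp (X.α x x) (X.α x x ⊓ Y.α (e x) y))
          = T.op (T.imp (Y.α (e x) (e x)) (Y.α (e x) y'))
              (T.op (X.α x x) (T.imp (X.α x x) (X.α x x ⊓ Y.α (e x) y))) := by
            rw [← op_imp_α_map_eq_inf he hext x y']; ac_rfl
        _ ≤ T.op (T.imp (Y.α (e x) (e x)) (Y.α (e x) y')) (Y.α y (e x)) :=
            T.op_mono le_rfl ((T.op_imp_le _ _).trans (inf_le_right.trans_eq (Y.symm _ _)))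
        _ ≤ Y.α y y' := Y.op_imp_α_le _ _ _
    rel_total := fun x x' => by
      have hle : X.α x' x ≤ Y.α (e x) (e x) := (X.le_right x' x).trans (he x x)
      refine le_trans ?_ (le_iSup _ (e x))
      rw [inf_eq_left.2 (he x x)]
      calc X.α x x' = T.op (X.α x' x) (T.imp (Y.α (e x) (e x)) (X.α x x)) := by
            rw [T.op_imp_swap hle (he x x), T.op_comm,
              ContinuousTNorm.op_imp_eq_inf_of_op_imp_eq_left (he x x) hle (hext x),
              inf_eq_right.2 (X.le_right x' x), X.symm]
        _ ≤ T.op (X.α x' x' ⊓ Y.α (e x') (e x)) (T.imp (Y.α (e x) (e x)) (X.α x x)) :=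
            T.op_mono (le_inf (X.le_left x' x) (he x' x)) le_rfl }

variable {he : ∀ x x', X.α x x' ≤ Y.α (e x) (e x')}
  {hext : ∀ x, T.op (X.α x x) (T.imp (Y.α (e x) (e x)) (X.α x x)) = X.α x x}

theorem graph_comp_rel (k : Y ⟶ Z) (x : X.carrier) (z : Z.carrier) :
    (graph e he hext ≫ k).rel x z = X.α x x ⊓ k.rel (e x) z := by
  refine le_antisymm (iSup_le fun y => le_inf ?_ ?_) ?_
  · exact (T.op_imp_le_right (k.rel_le_left y z) ((graph e he hext).rel_le_right x y)).trans
      inf_le_left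
  · exact (T.op_mono le_rfl (T.imp_mono_right _ inf_le_right)).trans (k.rel_compat_left y (e x) z)
  · refine le_trans (le_of_eq ?_) (le_iSup _ (e x))
    change _ = T.op _ (T.imp _ (X.α x x ⊓ Y.α (e x) (e x)))
    rw [inf_eq_left.2 (he x x), T.op_imp_swap (k.rel_le_left _ z) (he x x), T.op_comm,
      ContinuousTNorm.op_imp_eq_inf_of_op_imp_eq_left (he x x) (k.rel_le_left _ z) (hext x)]

theorem graph_comp_rel_of_extent_eq (h : ∀ x, X.α x x = Y.α (e x) (e x)) (k : Y ⟶ Z)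
    (x : X.carrier) : (graph e he hext ≫ k).rel x = k.rel (e x) := by
  funext z
  rw [graph_comp_rel, h, inf_eq_right.2 (k.rel_le_left _ z)]

theorem epi_graph_of_surjective (h : ∀ x, X.α x x = Y.α (e x) (e x))
    (hsurj : Function.Surjective e) : Epi (graph e he hext) where
  left_cancellation k l hkl := ext_rel <| hsurj.forall.2 fun x => by
    rw [← graph_comp_rel_of_extent_eq (he := he) (hext := hext) h, hkl,
      graph_comp_rel_of_extent_eq h]

theorem α_map_eq_of_isIso_graph (h : ∀ x, X.α x x = Y.α (e x) (e x))
    [hiso : IsIso (graph e he hext)] (x x' : X.carrier) : Y.α (e x) (e x') = X.α x x' := by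
  have hinv : ∀ x, (inv (graph e he hext)).rel (e x) = X.α x := fun x => by
    rw [← graph_comp_rel_of_extent_eq (he := he) (hext := hext) h, IsIso.hom_inv_id]
    rfl
  refine le_antisymm ?_ (he x x')
  simpa only [hinv, h x', T.op_imp_of_le (Y.le_right _ _)] using
    (inv (graph e he hext)).rel_compat_left (e x') (e x) x'

end graph

end Hom

section equidistant

variable {ι : Type u} [DecidableEq ι] {p r r' : unitInterval}

variable (T ι) in
/-- The `[0,1]_*`-set on `ι` whose elements all have extent `p`, any two of them being equal to
the degree `r`. -/
abbrev equidistant (h : r ≤ p) : TNormSet.{u} T where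
  carrier := ι
  α x y := if x = y then p else r
  le_min x y := by
    simp only [if_true, min_self]
    split_ifs <;> simp [h]
  symm x y := by simp only [eq_comm]
  trans x y z := by
    by_cases hxy : x = y
    · simpa only [hxy, if_true] using T.op_le_left _ _
    · refine (T.op_mono (q' := T.imp p r) (p' := p) ?_ ?_).trans ((T.op_imp_le p r).trans ?_)
      · split_ifs <;> simp [h]
      · simp only [hxy, if_true, if_false, le_refl]
      · split_ifs <;> simp [h]

theorem equidistant_α_self (h : r ≤ p) (x : ι) :
    (equidistant T ι h).α x x = p := if_pos rfl

theorem equidistant_α_of_ne (h : r ≤ p) {x y : ι} (hxy : x ≠ y) :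
    (equidistant T ι h).α x y = r := if_neg hxy

theorem le_equidistant_α (h : r ≤ p) (x y : ι) :
    r ≤ (equidistant T ι h).α x y := by
  by_cases hxy : x = y
  · rwa [hxy, equidistant_α_self]
  · exact (equidistant_α_of_ne h hxy).ge

theorem equidistant_α_mono (h : r ≤ r') (h' : r' ≤ p) (x y : ι) :
    (equidistant T ι (h.trans h')).α x y ≤ (equidistant T ι h').α x y := by
  by_cases hxy : x = y
  · exact (if_pos hxy).trans_le (if_pos hxy).ge
  · exact ((if_neg hxy).trans_le h).trans (if_neg hxy).ge

variable (T ι) in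
/-- The identity of `ι`, as a morphism raising the degree of equality of distinct elements. -/
noncomputable def equidistantRelax (h : r ≤ r') (h' : r' ≤ p) :
    equidistant T ι (h.trans h') ⟶ equidistant T ι h' :=
  Hom.graph (fun x => x) (equidistant_α_mono h h') fun x => by
    rw [equidistant_α_self, equidistant_α_self, T.imp_self, T.op_one]

theorem equidistant_extent_eq (h : r ≤ r') (h' : r' ≤ p) (x : ι) :
    (equidistant T ι (h.trans h')).α x x = (equidistant T ι h').α x x :=
  (equidistant_α_self _ _).trans (equidistant_α_self h' x).symm

theorem epi_equidistantRelax (h : r ≤ r') (h' : r' ≤ p) : Epi (equidistantRelax T ι h h') :=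
  Hom.epi_graph_of_surjective (equidistant_extent_eq h h') Function.surjective_id

theorem equidistantRelax_rel (h : r ≤ r') (h' : r' ≤ p) (x : ι) :
    (equidistantRelax T ι h h').rel x = (equidistant T ι h').α x := by
  funext y
  refine inf_eq_right.2 (((equidistant T ι h').le_left x y).trans_eq ?_)
  rw [equidistant_α_self, equidistant_α_self]

theorem not_isIso_equidistantRelax [Nontrivial ι] (h : r < r') (h' : r' ≤ p) :
    ¬ IsIso (equidistantRelax T ι h.le h') := by
  intro hiso
  obtain ⟨x, x', hne⟩ := exists_pair_ne ι
  have heq := Hom.α_map_eq_of_isIso_graph (hiso := hiso) (equidistant_extent_eq h.le h') x x'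
  exact h.ne' ((if_neg hne).symm.trans (heq.trans (if_neg hne)))

theorem exists_rel_eq_extent [Finite ι] [Nonempty ι] (h : r ≤ p) {Z : TNormSet.{u} T}
    (g : Z ⟶ equidistant T ι h) (z : Z.carrier) :
    ∃ x, g.rel z x = Z.α z z ∧ T.op (Z.α z z) (T.imp p (Z.α z z)) = Z.α z z := by
  have htotal := g.rel_total z z
  obtain ⟨x, hx⟩ := exists_eq_ciSup_of_finite
    (f := fun x => T.op (g.rel z x) (T.imp ((equidistant T ι h).α x x) (g.rel z x)))
  rw [← hx, equidistant_α_self] at htotal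
  have hgx : g.rel z x = Z.α z z := (g.rel_le_left z x).antisymm (htotal.trans (T.op_le_left _ _))
  rw [hgx] at htotal
  exact ⟨x, hgx, (T.op_le_left _ _).antisymm htotal⟩

/-- A point of extent `c < p` of `equidistant T ι h` forces `c` to be idempotent, so that it lies
below `r` and does not distinguish the elements of `ι`. -/
theorem rel_eq_extent_or_eq_α [Finite ι] [Nonempty ι] (h : r ≤ p)
    (hr : ∀ c ≤ p, T.op c c = c → c ≤ r) {Z : TNormSet.{u} T}
    (g : Z ⟶ equidistant T ι h) (z : Z.carrier) :
    (T.op (Z.α z z) (Z.α z z) = Z.α z z ∧ g.rel z = fun _ => Z.α z z) ∨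
      (Z.α z z = p ∧ ∃ x, g.rel z = (equidistant T ι h).α x) := by
  obtain ⟨x, hx, hfix⟩ := exists_rel_eq_extent h g z
  have hp : Z.α z z ≤ p := hx.ge.trans ((g.rel_le_right z x).trans_eq (equidistant_α_self h x))
  have hcompat : ∀ y, T.op (T.imp p ((equidistant T ι h).α x y)) (Z.α z z) ≤ g.rel z y := by
    intro y
    have := g.rel_compat_right z x y
    rwa [equidistant_α_self, hx] at this
  rcases ContinuousTNorm.eq_or_idempotent_of_op_imp_eq_left hp hfix with hz | hz
  · refine Or.inr ⟨hz, x, funext fun y => le_antisymm ?_ ?_⟩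
    · simpa only [hx, T.imp_self, T.op_one] using g.rel_single z x y
    · refine le_trans ?_ (hcompat y)
      rw [hz, T.op_comm, T.op_imp_of_le]
      exact ((equidistant T ι h).le_left x y).trans_eq (equidistant_α_self h x)
  · refine Or.inl ⟨hz, funext fun y => le_antisymm (g.rel_le_left z y) (le_trans ?_ (hcompat y))⟩
    refine hz.ge.trans (T.op_mono (T.le_imp_iff.2 ?_) le_rfl)
    exact (T.op_le_right _ _).trans ((hr _ hp hz).trans (le_equidistant_α h x y))

theorem mono_equidistantRelax [Finite ι] [Nonempty ι] (h : r ≤ r') (h' : r' < p)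
    (hr : ∀ c ≤ p, T.op c c = c → c ≤ r) : Mono (equidistantRelax T ι h h'.le) where
  right_cancellation {Z} g k hgk := Hom.ext_rel fun z => by
    have hp : T.op p p ≠ p := fun hp => (hr p le_rfl hp).not_gt (h.trans_lt h')
    rcases rel_eq_extent_or_eq_α _ hr g z with ⟨hz, hg⟩ | ⟨hz, x, hg⟩ <;>
      rcases rel_eq_extent_or_eq_α _ hr k z with ⟨hz', hk⟩ | ⟨hz', y, hk⟩
    · rw [hg, hk]
    · exact absurd (hz' ▸ hz) hp
    · exact absurd (hz ▸ hz') hp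
    · have hxy : (equidistant T ι h'.le).α x = (equidistant T ι h'.le).α y := by
        rw [← equidistantRelax_rel h h'.le x, ← equidistantRelax_rel h h'.le y,
          ← Hom.comp_rel_of_rel_eq_α hg,
          hgk, Hom.comp_rel_of_rel_eq_α hk]
      obtain rfl : x = y := by
        by_contra hne
        have := (equidistant_α_self h'.le x).symm.trans (congrFun hxy x)
        rw [equidistant_α_of_ne h'.le (Ne.symm hne)] at this
        exact h'.ne' this
      rw [hg, hk]

end equidistant

theorem isMinimum_of_balanced [Balanced (TNormSet.{u} T)] : T.IsMinimum := by
  refine ContinuousTNorm.isMinimum_of_forall_idempotent fun p => ?_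
  obtain ⟨e, ⟨hep, he⟩, hmax⟩ := ContinuousTNorm.exists_greatest_idempotent_le (T := T) p
  rcases hep.eq_or_lt with rfl | hlt
  · exact he
  obtain ⟨r, her, hrp⟩ := exists_between hlt
  have := epi_equidistantRelax (T := T) (ι := ULift.{u} Bool) her.le hrp.le
  have := mono_equidistantRelax (T := T) (ι := ULift.{u} Bool) her.le hrp
    fun c hc hcc => hmax ⟨hc, hcc⟩
  exact absurd (isIso_of_mono_of_epi (equidistantRelax T (ULift.{u} Bool) her.le hrp.le))
    (not_isIso_equidistantRelax her hrp.le)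

end TNormSet

section Heyting

variable {α : Type*} [CompleteLinearOrder α] {a b c r : α}

theorem lt_iff_lt_of_lt_bihimp (h : r < a ⇔ b) : r < a ↔ r < b := by
  obtain ⟨hba, hab⟩ := le_bihimp_iff.1 (le_refl (a ⇔ b))
  exact ⟨fun ha => (lt_inf_iff.2 ⟨ha, h⟩).trans_le hab,
    fun hb => (lt_inf_iff.2 ⟨hb, h⟩).trans_le hba⟩

theorem le_bihimp_of_forall_lt_iff_lt (h : ∀ r < c, r < a ↔ r < b) : c ≤ a ⇔ b :=
  le_bihimp_iff.2
    ⟨le_of_forall_lt fun r hr => (h r (lt_inf_iff.1 hr).2).2 (lt_inf_iff.1 hr).1,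
      le_of_forall_lt fun r hr => (h r (lt_inf_iff.1 hr).2).1 (lt_inf_iff.1 hr).1⟩

theorem lt_iSup_inf_iff {ι : Sort*} {f g : ι → α} :
    r < ⨆ i, f i ⊓ g i ↔ ∃ i, r < f i ∧ r < g i := by
  simp only [lt_iSup_iff, lt_inf_iff]

end Heyting

namespace TNormSet

variable {T : ContinuousTNorm} {X Y Z U : TNormSet.{u} T} {r d : unitInterval}

section Extent

variable {x x' : X.carrier} {y : Y.carrier} {f : X ⟶ Y}

theorem lt_α_symm (h : r < X.α x x') : r < X.α x' x := by rwa [X.symm]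

theorem lt_α_left (h : r < X.α x x') : r < X.α x x := h.trans_le (X.le_left x x')

theorem Hom.lt_left (h : r < f.rel x y) : r < X.α x x := h.trans_le (f.rel_le_left x y)

theorem Hom.lt_right (h : r < f.rel x y) : r < Y.α y y := h.trans_le (f.rel_le_right x y)

theorem Hom.lt_total (f : X ⟶ Y) (h : r < X.α x x) : ∃ y, r < f.rel x y := by
  obtain ⟨y, hy⟩ := lt_iSup_iff.1 (h.trans_le (f.rel_total x x))
  exact ⟨y, hy.trans_le (T.op_le_left _ _)⟩

end Extent

variable (T) in
/-- The `[0,1]_*`-set with a single element, of extent `d`. Morphisms from it to `X` play the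
role of elements of `X` defined to the degree `d`. -/
abbrev onePoint (d : unitInterval) : TNormSet.{u} T where
  carrier := PUnit
  α _ _ := d
  le_min _ _ := (min_self d).ge
  symm _ _ := rfl
  trans _ _ _ := T.op_le_left _ _

variable [hT : Fact T.IsMinimum]

theorem lt_op_iff {a b : unitInterval} : r < T.op a b ↔ r < a ∧ r < b := by
  rw [hT.out, lt_min_iff]

theorem op_imp_eq_left (a q : unitInterval) : T.op a (T.imp q a) = a := by
  rw [hT.out]
  exact min_eq_left (T.le_imp_iff.2 (T.op_le_right q a))

theorem lt_op_imp_iff {a b q : unitInterval} (ha : a ≤ q) (hb : b ≤ q) :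
    r < T.op a (T.imp q b) ↔ r < a ∧ r < b := by
  rw [ContinuousTNorm.op_imp_eq_inf_of_op_imp_eq_left ha hb (op_imp_eq_left a q), lt_inf_iff]

/-- The `[0,1]_*`-set given by an equality `α` which is transitive with respect to `⊓`. -/
abbrev ofInfTrans {C : Type u} (α : C → C → unitInterval) (symm : ∀ x y, α x y = α y x)
    (trans : ∀ x y z, α x y ⊓ α y z ≤ α x z) : TNormSet.{u} T :=
  have le_left : ∀ x y, α x y ≤ α x x := fun x y =>
    (le_inf le_rfl (symm x y).le).trans (trans x y x)
  have le_right : ∀ x y, α x y ≤ α y y := fun x y => (symm x y).trans_le (le_left y x)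
  { carrier := C
    α := α
    le_min := fun x y => _root_.le_min (le_left x y) (le_right x y)
    symm := symm
    trans := fun x y z => le_of_forall_lt fun _ hr =>
      have h := (lt_op_imp_iff (le_left y z) (le_right x y)).1 hr
      (lt_inf_iff.2 h.symm).trans_le (trans x y z) }

section Levels

variable {x x' x'' : X.carrier} {y y' : Y.carrier} {z : Z.carrier} {f : X ⟶ Y} {g : Y ⟶ Z}

theorem lt_α_trans (h : r < X.α x x') (h' : r < X.α x' x'') : r < X.α x x'' :=
  ((lt_op_imp_iff (X.le_left x' x'') (X.le_right x x')).2 ⟨h', h⟩).trans_le (X.trans x x' x'')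

theorem α_inf_α_le (X : TNormSet.{u} T) (x x' x'' : X.carrier) :
    X.α x x' ⊓ X.α x' x'' ≤ X.α x x'' :=
  le_of_forall_lt fun _ hr => lt_α_trans (lt_inf_iff.1 hr).1 (lt_inf_iff.1 hr).2

namespace Hom

theorem lt_compat_left (h : r < f.rel x y) (hx : r < X.α x x') : r < f.rel x' y :=
  ((lt_op_imp_iff (f.rel_le_left x y) (X.le_right x' x)).2 ⟨h, lt_α_symm hx⟩).trans_le
    (f.rel_compat_left x x' y)

theorem lt_compat_right (h : r < f.rel x y) (hy : r < Y.α y y') : r < f.rel x y' := by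
  refine lt_of_lt_of_le ?_ (f.rel_compat_right x y y')
  rw [T.op_comm]
  exact (lt_op_imp_iff (f.rel_le_right x y) (Y.le_left y y')).2 ⟨h, hy⟩

theorem lt_compat (h : r < f.rel x y) (hx : r < X.α x x') (hy : r < Y.α y y') :
    r < f.rel x' y' := lt_compat_right (lt_compat_left h hx) hy

theorem lt_single (h : r < f.rel x y) (h' : r < f.rel x y') : r < Y.α y y' :=
  ((lt_op_imp_iff (f.rel_le_left x y') (f.rel_le_left x y)).2 ⟨h', h⟩).trans_le
    (f.rel_single x y y')

theorem lt_comp_iff : r < (f ≫ g).rel x z ↔ ∃ y, r < f.rel x y ∧ r < g.rel y z := by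
  refine lt_iSup_iff.trans (exists_congr fun y => ?_)
  rw [lt_op_imp_iff (g.rel_le_left y z) (f.rel_le_right x y), and_comm]

/-- Comparable functional relations are equal. -/
theorem ext_of_lt {f g : X ⟶ Y} (h : ∀ r x y, r < f.rel x y → r < g.rel x y) : f = g := by
  refine ext_rel fun x => funext fun y => le_antisymm (le_of_forall_lt fun r => h r x y)
    (le_of_forall_lt fun r hr => ?_)
  obtain ⟨y', hy'⟩ := f.lt_total (lt_left hr)
  exact lt_compat_right hy' (lt_single (h _ _ _ hy') hr)

/-- For the minimum t-norm, a morphism amounts to a relation all of whose strict upper level sets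
are functional relations. -/
def ofLevels (rel : X.carrier → Y.carrier → unitInterval)
    (left : ∀ {r x y}, r < rel x y → r < X.α x x)
    (compat : ∀ {r x x' y y'}, r < rel x y → r < X.α x x' → r < Y.α y y' → r < rel x' y')
    (single : ∀ {r x y y'}, r < rel x y → r < rel x y' → r < Y.α y y')
    (total : ∀ {r x}, r < X.α x x → ∃ y, r < rel x y) : X ⟶ Y :=
  have le_left : ∀ x y, rel x y ≤ X.α x x := fun x y => le_of_forall_lt fun _ => left
  have le_right : ∀ x y, rel x y ≤ Y.α y y := fun x y => le_of_forall_lt fun _ hr => single hr hr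
  { rel := rel
    rel_le_min := fun x y => _root_.le_min (le_left x y) (le_right x y)
    rel_compat := fun x x' y y' => le_of_forall_lt fun _ hr => by
      obtain ⟨⟨hy, hxy⟩, hx⟩ := (lt_op_iff.trans (and_congr_left' lt_op_iff)).1 hr
      have hy' := (lt_op_imp_iff (le_right x y) (Y.le_left y y')).1 (lt_op_iff.2 ⟨hxy, hy⟩)
      have hx' := (lt_op_imp_iff (le_left x y) (X.le_right x' x)).1 (lt_op_iff.2 ⟨hxy, hx⟩)
      exact compat hxy (lt_α_symm hx'.2) hy'.2
    rel_single := fun x y y' => le_of_forall_lt fun _ hr =>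
      have h := (lt_op_imp_iff (le_left x y') (le_left x y)).1 hr
      single h.2 h.1
    rel_total := fun x x' => le_of_forall_lt fun _ hr => by
      obtain ⟨y, hy⟩ := total (lt_α_left hr)
      exact lt_iSup_iff.2 ⟨y, (lt_op_imp_iff (le_right x' y) (le_right x y)).2
        ⟨compat hy hr (single hy hy), hy⟩⟩ }

/-- The morphism represented by a map which does not decrease degrees of equality. -/
noncomputable def map (e : X.carrier → Y.carrier) (he : ∀ x x', X.α x x' ≤ Y.α (e x) (e x')) :
    X ⟶ Y :=
  graph e he fun _ => op_imp_eq_left _ _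

variable {e : X.carrier → Y.carrier} {he : ∀ x x', X.α x x' ≤ Y.α (e x) (e x')}

theorem lt_map_iff : r < (map e he).rel x y ↔ r < X.α x x ∧ r < Y.α (e x) y := lt_inf_iff

theorem lt_map_comp_iff :
    r < (map e he ≫ g).rel x z ↔ r < X.α x x ∧ r < g.rel (e x) z := by
  rw [map, graph_comp_rel, lt_inf_iff]

theorem lt_comp_map {k : Z ⟶ X} (h : r < k.rel z x) : r < (k ≫ map e he).rel z (e x) :=
  lt_comp_iff.2 ⟨x, h, lt_map_iff.2 ⟨lt_right h, (lt_right h).trans_le (he x x)⟩⟩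

end Hom

end Levels

section FiniteLimits

/-- The morphism to the terminal object. -/
noncomputable def toTerminal (X : TNormSet.{u} T) : X ⟶ onePoint T ⊤ :=
  Hom.map (fun _ => ⟨⟩) fun _ _ => le_top

noncomputable def isTerminal : IsTerminal (onePoint.{u} T ⊤) :=
  IsTerminal.ofUniqueHom toTerminal fun _ _ => Hom.ext_of_lt fun _ _ _ h =>
    Hom.lt_map_iff.2 ⟨Hom.lt_left h, Hom.lt_right h⟩

/-- The cartesian product of the underlying sets, with componentwise equality. -/
abbrev prod (X Y : TNormSet.{u} T) : TNormSet.{u} T :=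
  ofInfTrans (C := X.carrier × Y.carrier) (fun p q => X.α p.1 q.1 ⊓ Y.α p.2 q.2)
    (fun p q => by rw [X.symm, Y.symm])
    (fun p q s => by
      rw [inf_inf_inf_comm]
      exact inf_le_inf (X.α_inf_α_le _ _ _) (Y.α_inf_α_le _ _ _))

/-- The first projection. -/
noncomputable def fst : prod X Y ⟶ X := Hom.map Prod.fst fun _ _ => inf_le_left

/-- The second projection. -/
noncomputable def snd : prod X Y ⟶ Y := Hom.map Prod.snd fun _ _ => inf_le_right

/-- The pairing of two morphisms with the same source. -/
def lift (f : Z ⟶ X) (g : Z ⟶ Y) : Z ⟶ prod X Y :=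
  Hom.ofLevels (fun z p => f.rel z p.1 ⊓ g.rel z p.2)
    (fun h => Hom.lt_left (lt_inf_iff.1 h).1)
    (fun h hz hp => lt_inf_iff.2
      ⟨Hom.lt_compat (lt_inf_iff.1 h).1 hz (lt_inf_iff.1 hp).1,
        Hom.lt_compat (lt_inf_iff.1 h).2 hz (lt_inf_iff.1 hp).2⟩)
    (fun h h' => lt_inf_iff.2
      ⟨Hom.lt_single (lt_inf_iff.1 h).1 (lt_inf_iff.1 h').1,
        Hom.lt_single (lt_inf_iff.1 h).2 (lt_inf_iff.1 h').2⟩)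
    (fun h => by
      obtain ⟨x, hx⟩ := f.lt_total h
      obtain ⟨y, hy⟩ := g.lt_total h
      exact ⟨(x, y), lt_inf_iff.2 ⟨hx, hy⟩⟩)

theorem lt_lift_iff {f : Z ⟶ X} {g : Z ⟶ Y} {z : Z.carrier} {p : (prod X Y).carrier} :
    r < (lift f g).rel z p ↔ r < f.rel z p.1 ∧ r < g.rel z p.2 := lt_inf_iff

theorem lift_fst (f : Z ⟶ X) (g : Z ⟶ Y) : lift f g ≫ fst = f :=
  Hom.ext_of_lt fun _ _ _ h => by
    obtain ⟨p, hp, hx⟩ := Hom.lt_comp_iff.1 h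
    exact Hom.lt_compat_right (lt_lift_iff.1 hp).1 (Hom.lt_map_iff.1 hx).2

theorem lift_snd (f : Z ⟶ X) (g : Z ⟶ Y) : lift f g ≫ snd = g :=
  Hom.ext_of_lt fun _ _ _ h => by
    obtain ⟨p, hp, hy⟩ := Hom.lt_comp_iff.1 h
    exact Hom.lt_compat_right (lt_lift_iff.1 hp).2 (Hom.lt_map_iff.1 hy).2

theorem eq_lift (k : Z ⟶ prod X Y) : k = lift (k ≫ fst) (k ≫ snd) :=
  Hom.ext_of_lt fun _ _ _ h => lt_lift_iff.2 ⟨Hom.lt_comp_map h, Hom.lt_comp_map h⟩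

variable (X Y) in
noncomputable def isLimitProd : IsLimit (BinaryFan.mk (fst : prod X Y ⟶ X) snd) :=
  BinaryFan.isLimitMk (fun s => lift s.fst s.snd) (fun s => lift_fst s.fst s.snd)
    (fun s => lift_snd s.fst s.snd) fun s k hfst hsnd => by
      rw [eq_lift k, hfst, hsnd]

/-- Injectivity of a morphism at each strict level, which characterizes monomorphisms. -/
def LevelInjective (m : U ⟶ X) : Prop :=
  ∀ ⦃r u u' x⦄, r < m.rel u x → r < m.rel u' x → r < U.α u u'

/-- An element of `X`, restricted to the degree `d`. -/
noncomputable def point (x : X.carrier) (h : d ≤ X.α x x) : onePoint T d ⟶ X :=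
  Hom.map (fun _ => x) fun _ _ => h

theorem LevelInjective.mono {m : U ⟶ X} (hm : LevelInjective m) : Mono m where
  right_cancellation g k hgk := Hom.ext_of_lt fun r z u h => by
    obtain ⟨x, hx⟩ := m.lt_total (Hom.lt_right h)
    have hzx : r < (k ≫ m).rel z x := hgk ▸ Hom.lt_comp_iff.2 ⟨u, h, hx⟩
    obtain ⟨u', hu', hx'⟩ := Hom.lt_comp_iff.1 hzx
    exact Hom.lt_compat_right hu' (hm hx' hx)

theorem LevelInjective.of_mono (m : U ⟶ X) [Mono m] : LevelInjective m := by
  intro r u u' x hu hu'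
  have hd : m.rel u x ⊓ m.rel u' x ≤ U.α u u := inf_le_left.trans (m.rel_le_left u x)
  have hd' : m.rel u x ⊓ m.rel u' x ≤ U.α u' u' := inf_le_right.trans (m.rel_le_left u' x)
  have hpoint : point u hd = point u' hd' := by
    rw [← cancel_mono m]
    refine Hom.ext_of_lt fun s _ y h => ?_
    obtain ⟨hs, hy⟩ := Hom.lt_map_comp_iff.1 h
    exact Hom.lt_map_comp_iff.2 ⟨hs, Hom.lt_compat_right (lt_inf_iff.1 hs).2
      (Hom.lt_single (lt_inf_iff.1 hs).1 hy)⟩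
  have h : r < (point u' hd').rel ⟨⟩ u' :=
    Hom.lt_map_iff.2 ⟨lt_inf_iff.2 ⟨hu, hu'⟩, Hom.lt_left hu'⟩
  rw [← hpoint] at h
  exact (Hom.lt_map_iff.1 h).2

namespace LevelInjective

variable {m : U ⟶ X} (hm : LevelInjective m) (f : Z ⟶ X)
  (hf : ∀ ⦃r z x⦄, r < f.rel z x → ∃ u, r < m.rel u x)

/-- The factorization of `f` through `m`, where `f` has values in the image of `m`. -/
noncomputable def factor : Z ⟶ U :=
  Hom.ofLevels (fun z u => ⨆ x, f.rel z x ⊓ m.rel u x)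
    (fun h => by
      obtain ⟨x, hx, -⟩ := lt_iSup_inf_iff.1 h
      exact Hom.lt_left hx)
    (fun h hz hu => by
      obtain ⟨x, hx, hux⟩ := lt_iSup_inf_iff.1 h
      exact lt_iSup_inf_iff.2 ⟨x, Hom.lt_compat_left hx hz, Hom.lt_compat_left hux hu⟩)
    (fun h h' => by
      obtain ⟨x, hx, hux⟩ := lt_iSup_inf_iff.1 h
      obtain ⟨x', hx', hux'⟩ := lt_iSup_inf_iff.1 h'
      exact hm (Hom.lt_compat_right hux (Hom.lt_single hx hx')) hux')
    (fun h => by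
      obtain ⟨x, hx⟩ := f.lt_total h
      obtain ⟨u, hu⟩ := hf hx
      exact ⟨u, lt_iSup_inf_iff.2 ⟨x, hx, hu⟩⟩)

theorem factor_comp : hm.factor f hf ≫ m = f :=
  Hom.ext_of_lt fun _ _ _ h => by
    obtain ⟨u, hu, hux⟩ := Hom.lt_comp_iff.1 h
    obtain ⟨x, hx, hux'⟩ := lt_iSup_inf_iff.1 hu
    exact Hom.lt_compat_right hx (Hom.lt_single hux' hux)

end LevelInjective

/-- The sub-`[0,1]_*`-set of `X` whose elements are cut down to the degrees given by `P`. -/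
abbrev sub (X : TNormSet.{u} T) (P : X.carrier → unitInterval) : TNormSet.{u} T :=
  ofInfTrans (fun x x' => X.α x x' ⊓ (P x ⊓ P x'))
    (fun x x' => by rw [X.symm, inf_comm (P x)])
    (fun x x' x'' => le_inf ((inf_le_inf inf_le_left inf_le_left).trans (X.α_inf_α_le x x' x''))
      (inf_le_inf (inf_le_right.trans inf_le_left) (inf_le_right.trans inf_le_right)))

/-- The inclusion of `sub X P` into `X`. -/
noncomputable def inclusion (P : X.carrier → unitInterval) : sub X P ⟶ X :=
  Hom.map (fun x => x) fun _ _ => inf_le_left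

theorem lt_inclusion_iff {P : X.carrier → unitInterval} {x x' : X.carrier} :
    r < (inclusion P).rel x x' ↔ r < P x ∧ r < X.α x x' :=
  Hom.lt_map_iff.trans
    ⟨fun h => ⟨(lt_inf_iff.1 (lt_inf_iff.1 h.1).2).1, h.2⟩,
      fun h => ⟨lt_inf_iff.2 ⟨lt_α_left h.2, lt_inf_iff.2 ⟨h.1, h.1⟩⟩, h.2⟩⟩

theorem levelInjective_inclusion (P : X.carrier → unitInterval) :
    LevelInjective (inclusion P) := fun _ _ _ _ h h' =>
  lt_inf_iff.2
    ⟨lt_α_trans (lt_inclusion_iff.1 h).2 (lt_α_symm (lt_inclusion_iff.1 h').2),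
      lt_inf_iff.2 ⟨(lt_inclusion_iff.1 h).1, (lt_inclusion_iff.1 h').1⟩⟩

/-- The degree to which `f` and `g` agree at an element. -/
noncomputable def agreement (f g : X ⟶ Y) (x : X.carrier) : unitInterval :=
  ⨆ y, f.rel x y ⊓ g.rel x y

theorem inclusion_agreement_condition (f g : X ⟶ Y) :
    inclusion (agreement f g) ≫ f = inclusion (agreement f g) ≫ g :=
  Hom.ext_of_lt fun _ x y h => by
    obtain ⟨hx, hy⟩ := Hom.lt_map_comp_iff.1 h
    obtain ⟨y', hf, hg⟩ := lt_iSup_inf_iff.1 (lt_inf_iff.1 (lt_inf_iff.1 hx).2).1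
    exact Hom.lt_map_comp_iff.2 ⟨hx, Hom.lt_compat_right hg (Hom.lt_single hf hy)⟩

theorem lt_agreement_of_comp_eq {f g : X ⟶ Y} {k : Z ⟶ X} (hk : k ≫ f = k ≫ g) {z : Z.carrier}
    {x : X.carrier} (h : r < k.rel z x) : r < agreement f g x := by
  obtain ⟨y, hy⟩ := f.lt_total (Hom.lt_right h)
  have hzy : r < (k ≫ g).rel z y := hk ▸ Hom.lt_comp_iff.2 ⟨x, h, hy⟩
  obtain ⟨x', hx', hy'⟩ := Hom.lt_comp_iff.1 hzy
  exact lt_iSup_inf_iff.2 ⟨y, hy, Hom.lt_compat_left hy' (Hom.lt_single hx' h)⟩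

noncomputable def isLimitAgreement (f g : X ⟶ Y) :
    IsLimit (Fork.ofι _ (inclusion_agreement_condition f g)) :=
  have hinj := levelInjective_inclusion (agreement f g)
  have hmem : ∀ (s : Fork f g) ⦃r z x⦄, r < s.ι.rel z x →
      ∃ u, r < (inclusion (agreement f g)).rel u x := fun s _ _ x h =>
    ⟨x, lt_inclusion_iff.2 ⟨lt_agreement_of_comp_eq s.condition h, Hom.lt_right h⟩⟩
  Fork.IsLimit.mk _ (fun s => hinj.factor s.ι (hmem s)) (fun s => hinj.factor_comp s.ι (hmem s))
    fun s k hk => by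
      have := hinj.mono
      exact (cancel_mono (inclusion (agreement f g))).1 (hk.trans (hinj.factor_comp s.ι _).symm)

variable (T) in
theorem hasFiniteLimits : HasFiniteLimits (TNormSet.{u} T) := by
  have : HasTerminal (TNormSet.{u} T) := isTerminal.hasTerminal
  have : ∀ X Y : TNormSet.{u} T, HasLimit (pair X Y) := fun X Y => ⟨⟨⟨_, isLimitProd X Y⟩⟩⟩
  have : HasBinaryProducts (TNormSet.{u} T) := hasBinaryProducts_of_hasLimit_pair _
  have : HasFiniteProducts (TNormSet.{u} T) := hasFiniteProducts_of_has_binary_and_terminal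
  have : ∀ {X Y : TNormSet.{u} T} {f g : X ⟶ Y}, HasLimit (parallelPair f g) :=
    fun {_ _ f g} => ⟨⟨⟨_, isLimitAgreement f g⟩⟩⟩
  have : HasEqualizers (TNormSet.{u} T) := hasEqualizers_of_hasLimit_parallelPair _
  exact hasFiniteLimits_of_hasEqualizers_and_finite_products

end FiniteLimits

section Exponential

/-- The exponential of `Y` by `X`: an element is a degree `d` together with a morphism from `X`
to `Y` defined to the degree `d`. -/
noncomputable abbrev exp (X Y : TNormSet.{u} T) : TNormSet.{u} T :=
  ofInfTrans (C := Σ d : unitInterval, (prod (onePoint T d) X ⟶ Y))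
    (fun p q => p.1 ⊓ q.1 ⊓ ⨅ x, ⨅ y, p.2.rel (⟨⟩, x) y ⇔ q.2.rel (⟨⟩, x) y)
    (fun p q => by simp only [inf_comm p.1, bihimp_comm])
    (fun p q s => le_inf
      (le_inf (inf_le_left.trans (inf_le_left.trans inf_le_left))
        (inf_le_right.trans (inf_le_left.trans inf_le_right)))
      (le_iInf₂ fun x y =>
        le_trans (inf_le_inf (inf_le_right.trans ((iInf_le _ x).trans (iInf_le _ y)))
          (inf_le_right.trans ((iInf_le _ x).trans (iInf_le _ y))))
          (bihimp_triangle _ (q.2.rel (⟨⟩, x) y) _)))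

theorem exp_α_self (p : (exp X Y).carrier) : (exp X Y).α p p = p.1 := by
  change p.1 ⊓ p.1 ⊓ _ = p.1
  simp only [bihimp_self, iInf_top, inf_top_eq, inf_idem]

theorem lt_rel_iff_of_lt_exp_α {p q : (exp X Y).carrier} (h : r < (exp X Y).α p q)
    (x : X.carrier) (y : Y.carrier) : r < p.2.rel (⟨⟩, x) y ↔ r < q.2.rel (⟨⟩, x) y :=
  lt_iff_lt_of_lt_bihimp (h.trans_le (inf_le_right.trans ((iInf_le _ x).trans (iInf_le _ y))))

theorem le_exp_α {p q : (exp X Y).carrier} (hp : d ≤ p.1) (hq : d ≤ q.1)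
    (h : ∀ x y, ∀ r < d, r < p.2.rel (⟨⟩, x) y ↔ r < q.2.rel (⟨⟩, x) y) : d ≤ (exp X Y).α p q :=
  le_inf (le_inf hp hq) (le_iInf₂ fun x y => le_bihimp_of_forall_lt_iff_lt (h x y))

/-- The evaluation morphism. -/
noncomputable def eval : prod (exp X Y) X ⟶ Y :=
  Hom.ofLevels (fun q y => q.1.2.rel (⟨⟩, q.2) y)
    (fun {_ q _} h => (Hom.lt_left h).trans_eq (congrArg (· ⊓ _) (exp_α_self q.1).symm))
    (fun {_ q q' _ _} h hq hy => by
      obtain ⟨hexp, hx⟩ := lt_inf_iff.1 hq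
      have h' := (lt_rel_iff_of_lt_exp_α hexp _ _).1 h
      exact Hom.lt_compat h' (lt_inf_iff.2 ⟨(lt_inf_iff.1 (Hom.lt_left h')).1, hx⟩) hy)
    (fun h h' => Hom.lt_single h h')
    (fun {_ q} h => q.1.2.lt_total (h.trans_eq (congrArg (· ⊓ _) (exp_α_self q.1))))

/-- The morphism `g` with its first argument fixed. -/
noncomputable def fixFst (g : prod Z X ⟶ Y) (z : Z.carrier) : prod (onePoint T (Z.α z z)) X ⟶ Y :=
  Hom.map (Y := prod Z X) (fun q => (z, q.2)) (fun _ _ => le_rfl) ≫ g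

theorem lt_fixFst_iff {g : prod Z X ⟶ Y} {z : Z.carrier} {x : X.carrier} {y : Y.carrier} :
    r < (fixFst g z).rel (⟨⟩, x) y ↔ r < g.rel (z, x) y :=
  Hom.lt_map_comp_iff.trans (and_iff_right_of_imp Hom.lt_left)

/-- The transpose of `g`. -/
noncomputable def curry (g : prod Z X ⟶ Y) : Z ⟶ exp X Y :=
  Hom.map (fun z => ⟨Z.α z z, fixFst g z⟩) fun z z' =>
    le_exp_α (Z.le_left z z') (Z.le_right z z') fun x y r hr => by
      rw [lt_fixFst_iff, lt_fixFst_iff]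
      exact
        ⟨fun h => Hom.lt_compat_left h (lt_inf_iff.2 ⟨hr, (lt_inf_iff.1 (Hom.lt_left h)).2⟩),
          fun h => Hom.lt_compat_left h
            (lt_inf_iff.2 ⟨lt_α_symm hr, (lt_inf_iff.1 (Hom.lt_left h)).2⟩)⟩

/-- The functor `- × X`, for the concrete product. -/
noncomputable abbrev prodFunctor (X : TNormSet.{u} T) : TNormSet.{u} T ⥤ TNormSet.{u} T where
  obj Z := prod Z X
  map k := lift (fst ≫ k) snd
  map_id Z := by
    rw [eq_lift (𝟙 (prod Z X)), Category.id_comp, Category.id_comp, Category.comp_id]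
  map_comp k l := by
    rw [eq_lift (lift _ _ ≫ lift _ _)]
    simp only [Category.assoc, lift_fst, lift_snd, reassoc_of% lift_fst]

theorem lt_prodFunctor_map_iff {k : Z ⟶ U} {p : (prod Z X).carrier} {q : (prod U X).carrier} :
    r < ((prodFunctor X).map k).rel p q ↔ r < k.rel p.1 q.1 ∧ r < X.α p.2 q.2 := by
  refine lt_lift_iff.trans ?_
  rw [fst, snd, Hom.lt_map_comp_iff, Hom.lt_map_iff]
  exact ⟨fun h => ⟨h.1.2, h.2.2⟩, fun h =>
    have hp := lt_inf_iff.2 ⟨Hom.lt_left h.1, lt_α_left h.2⟩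
    ⟨⟨hp, h.1⟩, hp, h.2⟩⟩

theorem map_curry_eval (g : prod Z X ⟶ Y) : (prodFunctor X).map (curry g) ≫ eval = g :=
  Hom.ext_of_lt fun r _ y h => by
    obtain ⟨q, hq, hy⟩ := Hom.lt_comp_iff.1 h
    obtain ⟨hcurry, hx⟩ := lt_prodFunctor_map_iff.1 hq
    obtain ⟨hz, hexp⟩ := Hom.lt_map_iff.1 hcurry
    have hgy := lt_fixFst_iff.1 ((lt_rel_iff_of_lt_exp_α hexp q.2 y).2 hy)
    exact Hom.lt_compat_left hgy (lt_inf_iff.2 ⟨hz, lt_α_symm hx⟩)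

theorem curry_map_eval (k : Z ⟶ exp X Y) : curry ((prodFunctor X).map k ≫ eval) = k := by
  refine (Hom.ext_of_lt fun r z p h => Hom.lt_map_iff.2 ⟨Hom.lt_left h, h.trans_le ?_⟩).symm
  refine le_exp_α (k.rel_le_left z p) ((k.rel_le_right z p).trans_eq (exp_α_self p))
    fun x y s hs => lt_fixFst_iff.trans ⟨fun hxy => ?_, fun hxy => ?_⟩
  · obtain ⟨q, hq, hy⟩ := Hom.lt_comp_iff.1 hxy
    obtain ⟨hk, hx⟩ := lt_prodFunctor_map_iff.1 hq
    have hpy := (lt_rel_iff_of_lt_exp_α (Hom.lt_single hk hs) q.2 y).1 hy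
    exact Hom.lt_compat_left hpy
      (lt_inf_iff.2 ⟨(lt_inf_iff.1 (Hom.lt_left hpy)).1, lt_α_symm hx⟩)
  · exact Hom.lt_comp_iff.2 ⟨(p, x),
      lt_prodFunctor_map_iff.2 ⟨hs, (lt_inf_iff.1 (Hom.lt_left hxy)).2⟩, hxy⟩

/-- Currying, as a bijection. -/
noncomputable def curryEquiv (Z X Y : TNormSet.{u} T) :
    ((prodFunctor X).obj Z ⟶ Y) ≃ (Z ⟶ exp X Y) where
  toFun := curry
  invFun k := (prodFunctor X).map k ≫ eval
  left_inv := map_curry_eval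
  right_inv := curry_map_eval

theorem curry_naturality (k : U ⟶ Z) (g : prod Z X ⟶ Y) :
    curry ((prodFunctor X).map k ≫ g) = k ≫ curry g := by
  refine (curryEquiv U X Y).eq_symm_apply.1 ?_
  change _ = (prodFunctor X).map (k ≫ curry g) ≫ eval
  rw [Functor.map_comp, Category.assoc, map_curry_eval]

/-- The comparison of the concrete product with the chosen categorical one. -/
noncomputable def prodIso (Z X : TNormSet.{u} T) [HasBinaryProduct Z X] : prod Z X ≅ Z ⨯ X where
  hom := prod.lift fst snd
  inv := lift prod.fst prod.snd
  hom_inv_id := by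
    rw [eq_lift (prod.lift _ _ ≫ _), eq_lift (𝟙 _)]
    simp only [Category.assoc, lift_fst, lift_snd, prod.lift_fst, prod.lift_snd, Category.id_comp]
  inv_hom_id := by
    ext <;> simp only [Category.assoc, prod.lift_fst, prod.lift_snd, lift_fst, lift_snd,
      Category.id_comp]

theorem prodIso_naturality [HasBinaryProducts (TNormSet.{u} T)] (k : Z ⟶ U) :
    (prodFunctor X).map k ≫ (prodIso U X).hom = (prodIso Z X).hom ≫ prod.map k (𝟙 X) := by
  simp only [prodIso, prod.lift_map, prod.comp_lift, lift_fst, lift_snd, Category.comp_id]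

theorem isLeftAdjoint_prod (X : TNormSet.{u} T) [HasBinaryProducts (TNormSet.{u} T)] :
    (prod.functor.flip.obj X).IsLeftAdjoint :=
  have : (prodFunctor X).IsLeftAdjoint :=
    (Adjunction.adjunctionOfEquivRight (fun Z Y => curryEquiv Z X Y)
      fun _ _ _ k g => curry_naturality k g).isLeftAdjoint
  Functor.isLeftAdjoint_of_iso <|
    NatIso.ofComponents (F := prodFunctor X) (fun Z => prodIso Z X) fun k => prodIso_naturality k

end Exponential

section SubobjectClassifier

variable (T) in
/-- The object of truth values: the unit interval, with the Heyting biimplication as equality. -/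
noncomputable abbrev truthValues : TNormSet.{u} T :=
  ofInfTrans (C := ULift.{u} unitInterval) (fun a b => a.down ⇔ b.down)
    (fun _ _ => bihimp_comm _ _) (fun _ _ _ => bihimp_triangle _ _ _)

variable (T) in
/-- The truth value `true`. -/
noncomputable def truth : onePoint.{u} T ⊤ ⟶ truthValues T :=
  Hom.map (Y := truthValues T) (fun _ => ⟨⊤⟩) fun _ _ => (bihimp_self _).ge

theorem lt_truth_iff {t : PUnit.{u + 1}} {ω : (truthValues.{u} T).carrier} :
    r < (truth T).rel t ω ↔ r < ω.down := by
  refine Hom.lt_map_iff.trans ((and_iff_right_of_imp lt_top_of_lt).trans ?_)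
  change r < ⊤ ⇔ ω.down ↔ _
  rw [top_bihimp]

theorem lt_toTerminal_comp_truth_iff {x : X.carrier} {ω : (truthValues T).carrier} :
    r < (toTerminal X ≫ truth T).rel x ω ↔ r < X.α x x ∧ r < ω.down :=
  Hom.lt_map_comp_iff.trans (and_congr_right' lt_truth_iff)

/-- The characteristic morphism of `m`; it sends `x` to the degree to which `x` lies in the image
of `m`. -/
noncomputable def classify (m : U ⟶ X) : X ⟶ truthValues T :=
  Hom.map (Y := truthValues T) (fun x => ⟨⨆ u, m.rel u x⟩) fun x x' =>
    le_bihimp_of_forall_lt_iff_lt fun r hr => by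
      simp only [lt_iSup_iff]
      exact exists_congr fun u =>
        ⟨fun h => Hom.lt_compat_right h hr, fun h => Hom.lt_compat_right h (lt_α_symm hr)⟩

theorem comp_classify (m : U ⟶ X) : m ≫ classify m = toTerminal U ≫ truth T :=
  Hom.ext_of_lt fun r u ω h => by
    obtain ⟨x, hux, hω⟩ := Hom.lt_comp_iff.1 h
    exact lt_toTerminal_comp_truth_iff.2 ⟨Hom.lt_left hux,
      (lt_iff_lt_of_lt_bihimp (Hom.lt_map_iff.1 hω).2).1 (lt_iSup_iff.2 ⟨u, hux⟩)⟩

theorem exists_lt_rel_of_comp_classify_eq {m : U ⟶ X} {k : Z ⟶ X} {t : Z ⟶ onePoint T ⊤}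
    (hk : k ≫ classify m = t ≫ truth T) {z : Z.carrier} {x : X.carrier} (h : r < k.rel z x) :
    ∃ u, r < m.rel u x := by
  have hclassify : r < (k ≫ classify m).rel z ⟨⨆ u, m.rel u x⟩ := Hom.lt_comp_map h
  rw [hk] at hclassify
  obtain ⟨_, -, htruth⟩ := Hom.lt_comp_iff.1 hclassify
  exact lt_iSup_iff.1 (lt_truth_iff.1 htruth)

theorem isPullback_classify (m : U ⟶ X) [Mono m] :
    IsPullback m (toTerminal U) (classify m) (truth T) :=
  have hm := LevelInjective.of_mono m
  have hmem : ∀ (s : PullbackCone (classify m) (truth T)) ⦃r z x⦄, r < s.fst.rel z x →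
      ∃ u, r < m.rel u x := fun s _ _ _ => exists_lt_rel_of_comp_classify_eq s.condition
  .of_isLimit' ⟨comp_classify m⟩ <|
    PullbackCone.IsLimit.mk _ (fun s => hm.factor s.fst (hmem s))
      (fun s => hm.factor_comp s.fst (hmem s)) (fun _ => isTerminal.hom_ext _ _)
      fun s _ hk _ => (cancel_mono m).1 (hk.trans (hm.factor_comp s.fst _).symm)

theorem eq_classify {m : U ⟶ X} {χ : X ⟶ truthValues T}
    (h : IsPullback m (toTerminal U) χ (truth T)) : χ = classify m := by
  refine Hom.ext_of_lt fun r x ω hr => Hom.lt_map_iff.2 ⟨Hom.lt_left hr, hr.trans_le ?_⟩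
  refine le_bihimp_of_forall_lt_iff_lt fun s hs => lt_iSup_iff.trans ⟨?_, fun hω => ?_⟩
  · rintro ⟨u, hu⟩
    have hmχ : s < (m ≫ χ).rel u ω := Hom.lt_comp_iff.2 ⟨x, hu, hs⟩
    rw [h.w] at hmχ
    exact (lt_toTerminal_comp_truth_iff.1 hmχ).2
  · have hd : χ.rel x ω ⊓ ω.down ≤ X.α x x := inf_le_left.trans (χ.rel_le_left x ω)
    have hpoint : point x hd ≫ χ = toTerminal _ ≫ truth T :=
      Hom.ext_of_lt fun s' _ ω' h' => by
        obtain ⟨hs', hω'⟩ := Hom.lt_map_comp_iff.1 h'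
        obtain ⟨hxω, hω⟩ := lt_inf_iff.1 hs'
        exact lt_toTerminal_comp_truth_iff.2
          ⟨hs', (lt_iff_lt_of_lt_bihimp (Hom.lt_single hxω hω')).1 hω⟩
    have hx : s < (point x hd).rel ⟨⟩ x :=
      Hom.lt_map_iff.2 ⟨lt_inf_iff.2 ⟨hs, hω⟩, Hom.lt_left hs⟩
    rw [← h.lift_fst _ _ hpoint] at hx
    obtain ⟨u, -, hu⟩ := Hom.lt_comp_iff.1 hx
    exact ⟨u, hu⟩

variable (T) in
theorem hasSubobjectClassifier : HasSubobjectClassifier (TNormSet.{u} T) :=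
  ⟨⟨.mkOfTerminalΩ₀ _ isTerminal _ (truth T) (fun m _ => classify m)
    (fun m _ => isPullback_classify m) (fun _ _ _ h => eq_classify h)⟩⟩

end SubobjectClassifier

variable (T) in
theorem isTopos : IsTopos (TNormSet.{u} T) where
  hasFiniteLimits := hasFiniteLimits T
  exponentiable X := have := hasFiniteLimits T; isLeftAdjoint_prod X
  hasSubobjectClassifier := hasSubobjectClassifier T

end TNormSet

theorem mainTheorem3 (T : ContinuousTNorm) :
    IsTopos (TNormSet.{u} T) ↔ T.IsMinimum := by
  refine ⟨fun h => ?_, fun h => ?_⟩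
  · have := h.hasSubobjectClassifier
    exact TNormSet.isMinimum_of_balanced.{u}
  · have := Fact.mk h
    exact TNormSet.isTopos T
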